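/- Let $N\ge 1$ and $\mathsf{s}=(s_1,\dots,s_N)\in(0,1]^N$ with $\sum_k s_k<N$. Put $s=\min_k s_k$ (so $s<1$), $L=\{k: s_k=s\}$, $\alpha=\sum_k 1/s_k$, and $$d_{\mathsf s}(x,y)=\sum_{k=1}^N|x_k-y_k|^{s_k}\qquad(x,y\in\mathbb{R}^N).$$ Let $\mathcal H^\alpha$ be the $\alpha$-dimensional Hausdorff measure of the metric space $(\mathbb{R}^N,d_{\mathsf s})$. Let $l\ge 1$ be an integer so large that, with $h=2^{-l}$ and $\mu=h^s$, $$\mu\le\min\Big\{\tfrac14,\ (1-s)^s,\ \tfrac12\,(2^{l-1}-1)^{s/2}\Big\}.$$ For $n\ge 1$ let $\mathcal S_n=\big\{\big(h^{n-1}(m+\tfrac12),\,h^{n-1}(m+\tfrac12)+h^{n+1}\big): m\in\mathbb Z\big\}$ and let $\mathcal S=\bigcup_{n\ge1}\mathcal S_n$. Let $\mathcal R$ be the equivalence relation on $\mathbb R$ given by $x\,\mathcal R\,y$ if and only if $x=y$, $(x,y)\in\mathcal S$ or $(y,x)\in\mathcal S$. Define the semi-distance $$d_{\mathcal R}(x,y)=\inf\Big\{\sum_{k=0}^n|x_k-y_k|^s:\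 n\ge 0,\ x\,\mathcal R\,x_0,\ y_k\,\mathcal R\,x_{k+1}\ (0\le k<n),\ y_n\,\mathcal R\,y\Big\}$$ on $\mathbb R$ and the semi-distance $$d_{\mathsf s,\mathcal R}(x,y)=\sum_{k\in L}d_{\mathcal R}(x_k,y_k)+\sum_{k\notin L}|x_k-y_k|^{s_k}$$ on $\mathbb R^N$. **Theorem.** Let $A\subset[0,1]^N$ be closed (for the Euclidean topology) and let $g:(A,d_{\mathsf s,\mathcal R})\to(\mathbb R^N,d_{\mathsf s})$ be a Lipschitz map, i.e. there is a constant $C\ge 0$ with $d_{\mathsf s}(g(x),g(y))\le C\,d_{\mathsf s,\mathcal R}(x,y)$ for all $x,y\in A$, such that $\mathcal H^\alpha(g(A))>0$. Then there exists a Lipschitz map $f:([0,1]^N,d_{\mathsf s,\mathcal R})\to(\mathbb R^N,d_{\mathsf s})$ such that $\mathcal H^\alpha\big(f([0,1]^N)\big)>0$. -/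

import Mathlib

open MeasureTheory Set

/-! ### The snowflaked product distance on `ℝ^N` -/

/-- `d_s(x, y) = ∑ k, |x k - y k| ^ (s k)`. -/
noncomputable def snowflakeDist {N : ℕ} (s : Fin N → Ioc (0 : ℝ) 1) (x y : Fin N → ℝ) : ℝ :=
  ∑ k, |x k - y k| ^ (s k : ℝ)

/-- `ℝ^N`, as the carrier of the metric space `(ℝ^N, d_s)`. -/
def SnowflakeSpace {N : ℕ} (_s : Fin N → Ioc (0 : ℝ) 1) : Type := Fin N → ℝ

noncomputable instance {N : ℕ} (s : Fin N → Ioc (0 : ℝ) 1) : MetricSpace (SnowflakeSpace s) where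
  dist x y := snowflakeDist s x y
  dist_self x := by
    refine Finset.sum_eq_zero fun k _ => ?_
    rw [sub_self, abs_zero, Real.zero_rpow (s k).2.1.ne']
  dist_comm x y := Finset.sum_congr rfl fun k _ => by rw [abs_sub_comm]
  dist_triangle x y z := by
    unfold snowflakeDist
    rw [← Finset.sum_add_distrib]
    refine Finset.sum_le_sum fun k _ => ?_
    exact (Real.rpow_le_rpow (abs_nonneg _) (abs_sub_le (x k) (y k) (z k)) (s k).2.1.le).trans
      (Real.rpow_add_le_add_rpow (abs_nonneg _) (abs_nonneg _) (s k).2.1.le (s k).2.2)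
  eq_of_dist_eq_zero {x y} h := by
    change snowflakeDist s x y = 0 at h
    unfold snowflakeDist at h
    rw [Finset.sum_eq_zero_iff_of_nonneg
      fun k _ => Real.rpow_nonneg (abs_nonneg _) _] at h
    funext k
    have hk := h k (Finset.mem_univ k)
    rw [Real.rpow_eq_zero (abs_nonneg _) (s k).2.1.ne', abs_eq_zero] at hk
    exact sub_eq_zero.mp hk

noncomputable instance {N : ℕ} (s : Fin N → Ioc (0 : ℝ) 1) : MeasurableSpace (SnowflakeSpace s) :=
  borel _

instance {N : ℕ} (s : Fin N → Ioc (0 : ℝ) 1) : BorelSpace (SnowflakeSpace s) :=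
  ⟨rfl⟩

/-- The dimension `α = ∑ k, 1 / s k` of `(ℝ^N, d_s)`. -/
noncomputable def snowflakeDim {N : ℕ} (s : Fin N → Ioc (0 : ℝ) 1) : ℝ :=
  ∑ k, ((s k : ℝ))⁻¹

/-- The minimum snowflaking factor `min_k s k`. -/
noncomputable def minFactor {N : ℕ} (s : Fin N → Ioc (0 : ℝ) 1) : ℝ :=
  ⨅ k, (s k : ℝ)

/-! ### Quotient semi-distances -/

/-- The quotient semi-distance associated with a distance `d` and an equivalence relation `R`:
the infimum of `∑_{k=0}^{n} d(u k, v k)` over all itineraries `(u 0, v 0, …, u n, v n)`, that is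
`x R u 0`, `v k R u (k+1)` for `k < n`, and `v n R y`. -/
noncomputable def quotientSemidist {X : Type*} (d : X → X → ℝ) (R : X → X → Prop) (x y : X) : ℝ :=
  sInf {t : ℝ | ∃ (n : ℕ) (u v : ℕ → X),
    R x (u 0) ∧ (∀ k < n, R (v k) (u (k + 1))) ∧ R (v n) y ∧
    t = ∑ k ∈ Finset.range (n + 1), d (u k) (v k)}

/-! ### The shortcuts on the line, with `h = 2 ^ (-l)` -/

/-- The shortcuts of level `n ≥ 1`: all pairs
`(h^(n-1) (m + 1/2), h^(n-1) (m + 1/2) + h^(n+1))` with `m ∈ ℤ`, where `h = 1 / 2 ^ l`. -/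
def shortcutLevel (l n : ℕ) : Set (ℝ × ℝ) :=
  {z | ∃ m : ℤ, z.1 = (1 / 2 ^ l : ℝ) ^ (n - 1) * (m + 1 / 2) ∧
    z.2 = (1 / 2 ^ l : ℝ) ^ (n - 1) * (m + 1 / 2) + (1 / 2 ^ l : ℝ) ^ (n + 1)}

/-- The set of all shortcuts, of all levels `n ≥ 1` (from left to right end). -/
def shortcuts (l : ℕ) : Set (ℝ × ℝ) := ⋃ n ≥ 1, shortcutLevel l n

/-- Two reals are identified if they are equal or are the two ends of a shortcut. -/
def shortcutRel (l : ℕ) (x y : ℝ) : Prop :=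
  x = y ∨ (x, y) ∈ shortcuts l ∨ (y, x) ∈ shortcuts l

/-- The semi-distance `d_R` on `ℝ`: the quotient of `|x - y| ^ σ` by the shortcuts. -/
noncomputable def shortcutDist (l : ℕ) (σ : ℝ) : ℝ → ℝ → ℝ :=
  quotientSemidist (fun x y => |x - y| ^ σ) (shortcutRel l)

/-- The semi-distance `d_{s,R}` on `ℝ^N`: in `d_s`, the terms of the coordinates with minimal
snowflaking factor are replaced by `d_R`. -/
noncomputable def modifiedDist {N : ℕ} (s : Fin N → Ioc (0 : ℝ) 1) (l : ℕ)
    (x y : Fin N → ℝ) : ℝ :=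
  ∑ k, if (s k : ℝ) = minFactor s then shortcutDist l (minFactor s) (x k) (y k)
    else |x k - y k| ^ (s k : ℝ)

/-- The requirement that `l ≥ 1` is large enough with respect to the minimum snowflaking factor
`σ`: with `μ = h ^ σ`, `h = 1 / 2 ^ l`, one has
`μ ≤ min {1/4, (1 - σ)^σ, (1/2) (2^(l-1) - 1)^(σ/2)}`. -/
def LargeEnough (l : ℕ) (σ : ℝ) : Prop :=
  1 ≤ l ∧ (1 / 2 ^ l : ℝ) ^ σ ≤ 1 / 4 ∧ (1 / 2 ^ l : ℝ) ^ σ ≤ (1 - σ) ^ σ ∧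
    (1 / 2 ^ l : ℝ) ^ σ ≤ 1 / 2 * ((2 : ℝ) ^ (l - 1) - 1) ^ (σ / 2)

/-- `f`, restricted to `A`, is Lipschitz from the semi-distance `d` to the semi-distance `ρ`. -/
def IsLipschitzOn {X Y : Type*} (d : X → X → ℝ) (ρ : Y → Y → ℝ) (A : Set X) (f : X → Y) : Prop :=
  ∃ C : ℝ, 0 ≤ C ∧ ∀ x ∈ A, ∀ y ∈ A, ρ (f x) (f y) ≤ C * d x y

/-! ### `shortcutRel` is an equivalence relation -/

theorem odd_dyadic {a b : ℕ} {u v : ℤ} (hu : Odd u) (hv : Odd v)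
    (h : (u : ℝ) / 2 ^ a = v / 2 ^ b) : a = b ∧ u = v := by
  have h1 : (u : ℝ) * 2 ^ b = v * 2 ^ a := by field_simp at h; linarith
  have h2 : u * 2 ^ b = v * 2 ^ a := by exact_mod_cast h1
  have key : ∀ {a b : ℕ} {u v : ℤ}, Odd u → u * 2 ^ b = v * 2 ^ a → a ≤ b := by
    intro a b u v hu h
    by_contra hlt
    obtain ⟨c, rfl⟩ : ∃ c, a = b + (c + 1) := ⟨a - b - 1, by omega⟩
    have h3 : u = 2 * (v * 2 ^ c) := by
      have : (2 : ℤ) ^ b ≠ 0 := by positivity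
      apply mul_right_cancel₀ this
      rw [h]; ring
    rw [h3] at hu
    exact (Int.not_odd_iff_even.2 (even_two_mul _)) hu
  have hab : a = b := le_antisymm (key hu h2) (key hv h2.symm)
  subst hab
  exact ⟨rfl, mul_right_cancel₀ (by positivity) h2⟩

theorem shortcut_ends {l : ℕ} (hl : 2 ≤ l) {x y : ℝ} (h : (x, y) ∈ shortcuts l) :
    ∃ (n : ℕ) (u : ℤ), Odd u ∧ x = u / 2 ^ (l * n + 1) ∧ 
      ∃ w : ℤ, Odd w ∧ y = w / 2 ^ (l * (n + 2)) ∧ y = x + 1 / 2 ^ (l * (n + 2)) := by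
  simp only [shortcuts, mem_iUnion] at h
  obtain ⟨n, hn, m, hx, hy⟩ := h
  obtain ⟨n, rfl⟩ : ∃ k, n = k + 1 := ⟨n - 1, by omega⟩
  simp only [add_tsub_cancel_right] at hx hy
  obtain ⟨l, rfl⟩ : ∃ k, l = k + 1 := ⟨l - 1, by omega⟩
  have hx' : x = ((2 * m + 1 : ℤ) : ℝ) / 2 ^ ((l + 1) * n + 1) := by
    rw [hx, one_div_pow, ← pow_mul]; push_cast; field_simp; ring
  have hy' : y = x + 1 / 2 ^ ((l + 1) * (n + 2)) := by
    rw [hx, hy, one_div_pow, one_div_pow, ← pow_mul, ← pow_mul]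
  refine ⟨n, 2 * m + 1, ⟨m, rfl⟩, hx', (2 * m + 1) * 2 ^ (2 * l + 1) + 1, ?_, ?_, hy'⟩
  · exact ⟨(2 * m + 1) * 2 ^ (2 * l), by ring⟩
  · rw [hy', hx']
    have : (2 : ℝ) ^ ((l + 1) * (n + 2)) = 2 ^ ((l + 1) * n + 1) * 2 ^ (2 * l + 1) := by
      rw [← pow_add]; congr 1; ring
    rw [this]; push_cast; field_simp

theorem shortcutRel_equivalence {l : ℕ} (hl : 2 ≤ l) : Equivalence (shortcutRel l) := by
  refine ⟨fun x => Or.inl rfl, ?_, ?_⟩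
  · rintro x y (h | h | h)
    exacts [Or.inl h.symm, Or.inr (Or.inr h), Or.inr (Or.inl h)]
  · have hmod : ∀ a b : ℕ, l * a + 1 ≠ l * b := by
      intro a b h
      have : l ∣ 1 := (Nat.dvd_add_right (Dvd.intro a rfl)).1 (h ▸ Dvd.intro b rfl)
      have := Nat.le_of_dvd one_pos this
      omega
    have hl0 : 0 < l := by omega
    have no : ∀ {x y z : ℝ}, (x, y) ∈ shortcuts l → (y, z) ∈ shortcuts l → False := by
      intro x y z h1 h2
      obtain ⟨n, u, -, -, w, hw, hy, -⟩ := shortcut_ends hl h1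
      obtain ⟨n', u', hu', hx', -⟩ := shortcut_ends hl h2
      exact hmod _ _ (odd_dyadic hu' hw (hx'.symm.trans hy)).1
    rintro x y z (rfl | h | h) (rfl | h' | h')
    · exact Or.inl rfl
    · exact Or.inr (Or.inl h')
    · exact Or.inr (Or.inr h')
    · exact Or.inr (Or.inl h)
    · exact (no h h').elim
    · obtain ⟨n, u, -, -, w, hw, hy, hd⟩ := shortcut_ends hl h
      obtain ⟨n', u', -, -, w', hw', hy', hd'⟩ := shortcut_ends hl h'
      have := (odd_dyadic hw hw' (hy.symm.trans hy')).1
      rw [← this] at hd'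
      left; linarith
    · exact Or.inr (Or.inr h)
    · obtain ⟨n, u, hu, hx, w, hw, hy, hd⟩ := shortcut_ends hl h
      obtain ⟨n', u', hu', hx', w', hw', hy', hd'⟩ := shortcut_ends hl h'
      have h3 := (odd_dyadic hu hu' (hx.symm.trans hx')).1
      have : n = n' := Nat.eq_of_mul_eq_mul_left hl0 (by omega)
      subst this
      left; linarith
    · exact (no h' h).elim

theorem LargeEnough.two_le {l : ℕ} {σ : ℝ} (h : LargeEnough l σ) (hσ : σ ≤ 1) : 2 ≤ l := by
  obtain ⟨-, h4, -, -⟩ := h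
  have hp : (0 : ℝ) < 1 / 2 ^ l := by positivity
  have h1 : (1 / 2 ^ l : ℝ) ≤ 1 := by
    rw [div_le_one (by positivity)]; exact one_le_pow₀ one_le_two
  have h2 : (1 / 2 ^ l : ℝ) ≤ 1 / 4 := by
    simpa using (Real.rpow_le_rpow_of_exponent_ge hp h1 hσ).trans h4
  by_contra hl
  have hl' : l = 0 ∨ l = 1 := by omega
  rcases hl' with rfl | rfl <;> norm_num at h2

/-! The proof is a blow-up at nearly full cells followed by a limit. By uniqueness of Haar measure,
`ℋ^α` on `(ℝ^N, d_s)` has the same null sets as Lebesgue measure (`hausdorffMeasure_pos_iff`), so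
only volumes matter.

For `ρ = h^(nσ)`, with `σ` the minimal factor, the affine map `x_k ↦ ρ^(1/s_k) (x_k + m_k)`
multiplies `d_s` by exactly `ρ`. It multiplies `d_{s,R}` by at most `ρ`, since in the coordinates
with `s_k = σ` it is `x ↦ h^n (x + m)`, which sends shortcuts to shortcuts
(`modifiedDist_gridMap_le`). Rescaling source and target therefore keeps the Lipschitz constant.

Some `c > 0` works for all `ε`: there is a fine cell that `A` fills up to a proportion `ε` and whose
image has at least `c` times the volume of the cell (`exists_full_gridCell`). Rescaling such cells
to the unit cube gives maps `G n` on sets `E n` of nearly full measure, with images of volume at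
least `c` (`exists_blowUp`). An ultrafilter limit of the `G n` is Lipschitz on the whole cube. Every
neighbourhood of its compact image contains some `G n '' E n`, so that image has volume at least `c`
(`exists_limit_map`). -/

open Filter Topology

/-! ### The snowflaked distance, in coordinates -/

section Snowflake

variable {N : ℕ} {s : Fin N → Ioc (0 : ℝ) 1}

theorem snowflakeDist_nonneg (x y : Fin N → ℝ) : 0 ≤ snowflakeDist s x y :=
  Finset.sum_nonneg fun _ _ => Real.rpow_nonneg (abs_nonneg _) _

theorem abs_rpow_le_snowflakeDist (x y : Fin N → ℝ) (k : Fin N) :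
    |x k - y k| ^ (s k : ℝ) ≤ snowflakeDist s x y :=
  Finset.single_le_sum (f := fun k => |x k - y k| ^ (s k : ℝ))
    (fun _ _ => Real.rpow_nonneg (abs_nonneg _) _) (Finset.mem_univ k)

theorem abs_le_snowflakeDist_rpow (x y : Fin N → ℝ) (k : Fin N) :
    |x k - y k| ≤ snowflakeDist s x y ^ (s k : ℝ)⁻¹ := by
  have h := Real.rpow_le_rpow (Real.rpow_nonneg (abs_nonneg _) _)
    (abs_rpow_le_snowflakeDist (s := s) x y k) (inv_nonneg.2 (s k).2.1.le)
  rwa [Real.rpow_rpow_inv (abs_nonneg _) (s k).2.1.ne'] at h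

theorem continuous_snowflakeDist :
    Continuous fun p : (Fin N → ℝ) × (Fin N → ℝ) => snowflakeDist s p.1 p.2 := by
  unfold snowflakeDist
  refine continuous_finsetSum _ fun k _ => ?_
  exact Continuous.rpow_const (by fun_prop) fun _ => Or.inr (s k).2.1.le

theorem Filter.Tendsto.snowflakeDist {ι : Type*} {F : Filter ι} {b b' : ι → Fin N → ℝ}
    {y y' : Fin N → ℝ} (h : Tendsto b F (𝓝 y)) (h' : Tendsto b' F (𝓝 y')) :
    Tendsto (fun i => snowflakeDist s (b i) (b' i)) F (𝓝 (snowflakeDist s y y')) := by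
  have h1 := (continuous_snowflakeDist (s := s)).tendsto (y, y')
  have h2 := h1.comp (h.prodMk_nhds h')
  exact h2

theorem snowflakeDist_self (x : Fin N → ℝ) : snowflakeDist s x x = 0 :=
  dist_self (α := SnowflakeSpace s) x

theorem snowflakeDim_nonneg : 0 ≤ snowflakeDim s :=
  Finset.sum_nonneg fun k _ => inv_nonneg.2 (s k).2.1.le

/-- A set of small diameter for `d_s` has small volume. -/
theorem volume_le_of_snowflakeDist_le {E : Set (Fin N → ℝ)} {D : ℝ} (hD : 0 ≤ D)
    (h : ∀ x ∈ E, ∀ y ∈ E, snowflakeDist s x y ≤ D) :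
    volume E ≤ ENNReal.ofReal (2 ^ N * D ^ snowflakeDim s) := by
  rcases E.eq_empty_or_nonempty with rfl | ⟨a, ha⟩
  · simp
  have hsub : E ⊆ Icc (fun k => a k - D ^ (s k : ℝ)⁻¹) (fun k => a k + D ^ (s k : ℝ)⁻¹) := by
    intro x hx
    have hk : ∀ k, |x k - a k| ≤ D ^ (s k : ℝ)⁻¹ := fun k =>
      (abs_le_snowflakeDist_rpow (s := s) x a k).trans
        (Real.rpow_le_rpow (snowflakeDist_nonneg _ _) (h x hx a ha) (inv_nonneg.2 (s k).2.1.le))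
    exact ⟨fun k => by have := (abs_le.1 (hk k)).1; dsimp only; linarith,
      fun k => by have := (abs_le.1 (hk k)).2; dsimp only; linarith⟩
  refine (measure_mono hsub).trans ?_
  rw [Real.volume_Icc_pi, ← ENNReal.ofReal_prod_of_nonneg]
  · refine ENNReal.ofReal_le_ofReal (le_of_eq ?_)
    rw [snowflakeDim, Real.rpow_sum_of_nonneg hD fun k _ => inv_nonneg.2 (s k).2.1.le]
    have : ∀ k : Fin N, a k + D ^ (s k : ℝ)⁻¹ - (a k - D ^ (s k : ℝ)⁻¹)
        = 2 * D ^ (s k : ℝ)⁻¹ := fun k => by ring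
    simp only [this, Finset.prod_mul_distrib, Finset.prod_const, Finset.card_univ,
      Fintype.card_fin]
  · intro k _
    have := Real.rpow_nonneg hD (s k : ℝ)⁻¹
    linarith

/-! ### Comparison of the Hausdorff measure with the volume -/

/-- The metric `d_s` induces the usual topology of `ℝ^N`. -/
noncomputable def SnowflakeSpace.homeomorph (s : Fin N → Ioc (0 : ℝ) 1) :
    SnowflakeSpace s ≃ₜ (Fin N → ℝ) where
  toFun x := x
  invFun x := x
  left_inv _ := rfl
  right_inv _ := rfl
  continuous_toFun := by
    refine continuous_pi fun k => ?_
    rw [continuous_iff_continuousAt]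
    intro a
    rw [ContinuousAt, tendsto_iff_dist_tendsto_zero]
    have h0 : Tendsto (fun x : SnowflakeSpace s => dist x a ^ (s k : ℝ)⁻¹) (𝓝 a) (𝓝 0) := by
      have hc : Continuous fun x : SnowflakeSpace s => dist x a ^ (s k : ℝ)⁻¹ :=
        Continuous.rpow_const (by fun_prop) fun _ => Or.inr (inv_nonneg.2 (s k).2.1.le)
      have := hc.tendsto a
      rwa [dist_self, Real.zero_rpow (inv_ne_zero (s k).2.1.ne')] at this
    exact squeeze_zero (fun _ => dist_nonneg) (fun x => abs_le_snowflakeDist_rpow (s := s) x a k) h0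
  continuous_invFun := by
    refine continuous_iff_continuousAt.2 fun a => ?_
    refine (tendsto_iff_dist_tendsto_zero (α := SnowflakeSpace s)).2 ?_
    have hc : Continuous fun x : Fin N → ℝ => snowflakeDist s x a :=
      continuous_snowflakeDist.comp (by fun_prop : Continuous fun x : Fin N → ℝ => (x, a))
    have := hc.tendsto a
    rwa [snowflakeDist_self] at this

/-- The Hausdorff measure of `(ℝ^N, d_s)` in its dimension, as a measure on `ℝ^N`. -/
noncomputable def snowflakeMeasure (s : Fin N → Ioc (0 : ℝ) 1) : Measure (Fin N → ℝ) :=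
  (Measure.hausdorffMeasure (snowflakeDim s)).map (SnowflakeSpace.homeomorph s)

theorem snowflakeMeasure_apply (E : Set (Fin N → ℝ)) :
    snowflakeMeasure s E
      = Measure.hausdorffMeasure (X := SnowflakeSpace s) (snowflakeDim s) E :=
  MeasurableEquiv.map_apply (SnowflakeSpace.homeomorph s).toMeasurableEquiv E

/-- Mass distribution principle: a set of `d_s`-diameter `D` lies in a box of volume `2^N D^α`,
because the exponents `1/s_k` add up to `α`. The bound on the diameters only serves to make them
finite. -/
theorem volume_le_snowflakeMeasure (E : Set (Fin N → ℝ)) :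
    volume E ≤ 2 ^ N * snowflakeMeasure s E := by
  have h2 : (2 : ENNReal) ^ N ≠ 0 := by positivity
  have h2' : (2 : ENNReal) ^ N ≠ ⊤ := by finiteness
  let μ : Measure (SnowflakeSpace s) :=
    ((2 : ENNReal) ^ N)⁻¹ • (volume : Measure (Fin N → ℝ)).map (SnowflakeSpace.homeomorph s).symm
  have hμ : ∀ F : Set (SnowflakeSpace s),
      μ F = ((2 : ENNReal) ^ N)⁻¹ * volume (α := Fin N → ℝ) F := fun F => by
    simp only [μ, Measure.smul_apply, smul_eq_mul]
    congr 1
    exact MeasurableEquiv.map_apply (SnowflakeSpace.homeomorph s).symm.toMeasurableEquiv F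
  have key : μ ≤ Measure.hausdorffMeasure (snowflakeDim s) := by
    refine Measure.le_hausdorffMeasure _ μ 1 one_pos fun F hF => ?_
    have hfin : Metric.ediam F ≠ ⊤ := ne_top_of_le_ne_top ENNReal.one_ne_top hF
    have hvol : volume (α := Fin N → ℝ) F
        ≤ ENNReal.ofReal (2 ^ N * (Metric.ediam F).toReal ^ snowflakeDim s) := by
      refine volume_le_of_snowflakeDist_le (s := s) ENNReal.toReal_nonneg fun x hx y hy => ?_
      have h1 := (edist_dist (α := SnowflakeSpace s) x y).symm.trans_le
        (Metric.edist_le_ediam_of_mem hx hy)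
      exact (ENNReal.ofReal_le_iff_le_toReal hfin).1 h1
    rw [hμ]
    rw [ENNReal.ofReal_mul (by positivity), ENNReal.ofReal_pow (by norm_num),
      ← ENNReal.ofReal_rpow_of_nonneg ENNReal.toReal_nonneg snowflakeDim_nonneg,
      ENNReal.ofReal_toReal hfin, ENNReal.ofReal_ofNat] at hvol
    calc ((2 : ENNReal) ^ N)⁻¹ * volume (α := Fin N → ℝ) F
        ≤ ((2 : ENNReal) ^ N)⁻¹ * (2 ^ N * Metric.ediam F ^ snowflakeDim s) := by gcongr
      _ = _ := by rw [← mul_assoc, ENNReal.inv_mul_cancel h2 h2', one_mul]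
  have h := ((hμ E).symm.trans_le (key E)).trans_eq (snowflakeMeasure_apply E).symm
  calc volume E = 2 ^ N * (((2 : ENNReal) ^ N)⁻¹ * volume E) := by
        rw [← mul_assoc, ENNReal.mul_inv_cancel h2 h2', one_mul]
    _ ≤ _ := by gcongr

instance : (snowflakeMeasure s).IsAddLeftInvariant := by
  refine ⟨fun a => ?_⟩
  let τ : SnowflakeSpace s ≃ᵢ SnowflakeSpace s :=
    { toFun := fun x k => a k + x k
      invFun := fun x k => -a k + x k
      left_inv := fun x => funext fun k => neg_add_cancel_left (a k) (x k)
      right_inv := fun x => funext fun k => add_neg_cancel_left (a k) (x k)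
      isometry_toFun := Isometry.of_dist_eq fun x y => by
        change snowflakeDist s _ _ = snowflakeDist s _ _
        simp [snowflakeDist] }
  have h := IsometryEquiv.map_hausdorffMeasure τ (snowflakeDim s)
  ext1 E hE
  rw [Measure.map_apply (by fun_prop) hE, snowflakeMeasure_apply, snowflakeMeasure_apply]
  conv_rhs => rw [← h]
  exact (MeasurableEquiv.map_apply τ.toHomeomorph.toMeasurableEquiv E).symm

theorem ediam_box_le (ρ : ℝ) (hρ : 0 ≤ ρ) (a : Fin N → ℝ) (E : Set (SnowflakeSpace s))
    (hE : ∀ x ∈ E, ∀ k, x k ∈ Icc (a k) (a k + ρ ^ (s k : ℝ)⁻¹)) :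
    Metric.ediam E ≤ ENNReal.ofReal (N * ρ) := by
  refine Metric.ediam_le fun x hx y hy => ?_
  rw [edist_dist]
  refine ENNReal.ofReal_le_ofReal ?_
  change ∑ k, |x k - y k| ^ (s k : ℝ) ≤ N * ρ
  calc ∑ k, |x k - y k| ^ (s k : ℝ) ≤ ∑ k : Fin N, ρ := by
        refine Finset.sum_le_sum fun k _ => ?_
        have h1 := hE x hx k
        have h2 := hE y hy k
        have h3 : |x k - y k| ≤ ρ ^ (s k : ℝ)⁻¹ :=
          abs_le.2 ⟨by linarith [h1.1, h2.2], by linarith [h1.2, h2.1]⟩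
        have h4 := Real.rpow_le_rpow (abs_nonneg _) h3 (s k).2.1.le
        rwa [Real.rpow_inv_rpow hρ (s k).2.1.ne'] at h4
    _ = N * ρ := by simp

/-- Cover the cube by boxes with sides `r_k = ρ^(1/s_k)`, of `d_s`-diameter at most `N ρ`. There are
`∏ (⌊1/r_k⌋ + 1)` of them; as `(⌊1/r_k⌋ + 1) r_k ≤ 2` and `∏ r_k = ρ^α`, the covering sums are at
most `2^N N^α` for every `ρ`. -/
theorem snowflakeMeasure_cube_ne_top : snowflakeMeasure s (Icc 0 1) ≠ ⊤ := by
  rw [snowflakeMeasure_apply]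
  let ρ : ℕ → ℝ := fun n => (1 / 2) ^ n
  have hρ0 : ∀ n, 0 < ρ n := fun n => by positivity
  have hρ1 : ∀ n, ρ n ≤ 1 := fun n => pow_le_one₀ (by norm_num) (by norm_num)
  let r : ℕ → Fin N → ℝ := fun n k => ρ n ^ (s k : ℝ)⁻¹
  have hr0 : ∀ n k, 0 < r n k := fun n k => Real.rpow_pos_of_pos (hρ0 n) _
  have hr1 : ∀ n k, r n k ≤ 1 := fun n k =>
    Real.rpow_le_one (hρ0 n).le (hρ1 n) (inv_nonneg.2 (s k).2.1.le)
  let t : (n : ℕ) → ((k : Fin N) → Fin (⌊(r n k)⁻¹⌋₊ + 1)) → Set (SnowflakeSpace s) :=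
    fun n m => {x | ∀ k, x k ∈ Icc (r n k * (m k : ℕ)) (r n k * (m k : ℕ) + r n k)}
  have hdiam : ∀ n m, Metric.ediam (t n m) ≤ ENNReal.ofReal (N * ρ n) := fun n m =>
    ediam_box_le (ρ n) (hρ0 n).le (fun k => r n k * (m k : ℕ)) _ fun x hx => hx
  have hlim : Tendsto (fun n => ENNReal.ofReal (N * ρ n)) atTop (𝓝 0) := by
    rw [← ENNReal.ofReal_zero]
    refine ENNReal.tendsto_ofReal ?_
    have := (tendsto_pow_atTop_nhds_zero_of_lt_one (r := (1 / 2 : ℝ)) (by norm_num)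
      (by norm_num)).const_mul (N : ℝ)
    simpa only [mul_zero] using this
  have hcov : ∀ n, (Icc 0 1 : Set (Fin N → ℝ)) ⊆ ⋃ m, t n m := by
    intro n x hx
    have hb : ∀ k, ⌊x k / r n k⌋₊ < ⌊(r n k)⁻¹⌋₊ + 1 := fun k => by
      refine Nat.lt_succ_of_le (Nat.floor_le_floor ?_)
      rw [div_eq_mul_inv]
      exact mul_le_of_le_one_left (inv_nonneg.2 (hr0 n k).le) (hx.2 k)
    refine mem_iUnion.2 ⟨fun k => ⟨_, hb k⟩, fun k => ?_⟩
    have h1 := Nat.floor_le (div_nonneg (hx.1 k) (hr0 n k).le)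
    have h2 := (Nat.lt_floor_add_one (x k / r n k)).le
    rw [le_div_iff₀ (hr0 n k)] at h1
    rw [div_le_iff₀ (hr0 n k)] at h2
    exact ⟨by dsimp only; linarith, by dsimp only; linarith⟩
  have hsum : ∀ n, ∑ m, Metric.ediam (t n m) ^ snowflakeDim s
      ≤ ENNReal.ofReal (2 ^ N * (N : ℝ) ^ snowflakeDim s) := by
    intro n
    calc ∑ m, Metric.ediam (t n m) ^ snowflakeDim s
        ≤ ∑ m : ((k : Fin N) → Fin (⌊(r n k)⁻¹⌋₊ + 1)),
            ENNReal.ofReal (N * ρ n) ^ snowflakeDim s := by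
          gcongr with m
          · exact snowflakeDim_nonneg
          · exact hdiam n m
      _ = ENNReal.ofReal ((∏ k, ((⌊(r n k)⁻¹⌋₊ + 1 : ℕ) : ℝ)) * (N * ρ n) ^ snowflakeDim s) := by
          rw [Finset.sum_const, Finset.card_univ, Fintype.card_pi]
          simp only [Fintype.card_fin, nsmul_eq_mul]
          rw [ENNReal.ofReal_rpow_of_nonneg
            (mul_nonneg (by positivity) (hρ0 n).le) snowflakeDim_nonneg,
            ENNReal.ofReal_mul (by positivity), ← Nat.cast_prod, ENNReal.ofReal_natCast]
      _ ≤ _ := by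
          refine ENNReal.ofReal_le_ofReal ?_
          have hρα : ρ n ^ snowflakeDim s = ∏ k, r n k :=
            Real.rpow_sum_of_nonneg (hρ0 n).le fun k _ => inv_nonneg.2 (s k).2.1.le
          rw [Real.mul_rpow (Nat.cast_nonneg _) (hρ0 n).le, hρα, mul_left_comm, mul_comm,
            ← Finset.prod_mul_distrib]
          refine mul_le_mul_of_nonneg_right ?_ (Real.rpow_nonneg (Nat.cast_nonneg _) _)
          calc ∏ k, ((⌊(r n k)⁻¹⌋₊ + 1 : ℕ) : ℝ) * r n k ≤ ∏ k : Fin N, (2 : ℝ) := by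
                refine Finset.prod_le_prod (fun k _ => mul_nonneg (by positivity) (hr0 n k).le)
                  fun k _ => ?_
                have h1 := Nat.floor_le (inv_nonneg.2 (hr0 n k).le)
                have h2 := mul_le_mul_of_nonneg_right h1 (hr0 n k).le
                rw [inv_mul_cancel₀ (hr0 n k).ne'] at h2
                push_cast
                linarith [hr1 n k]
            _ = 2 ^ N := by simp
  refine ne_top_of_le_ne_top (b := ENNReal.ofReal (2 ^ N * (N : ℝ) ^ snowflakeDim s))
    ENNReal.ofReal_ne_top ?_
  refine (Measure.hausdorffMeasure_le_liminf_sum (snowflakeDim s) _ _ hlim t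
    (Eventually.of_forall hdiam) (Eventually.of_forall hcov)).trans ?_
  exact (liminf_le_liminf (Eventually.of_forall hsum)).trans_eq (liminf_const _)

theorem isAddHaarMeasure_snowflakeMeasure : (snowflakeMeasure s).IsAddHaarMeasure := by
  refine Measure.isAddHaarMeasure_of_isCompact_nonempty_interior _ (Icc 0 1) isCompact_Icc ?_ ?_
    snowflakeMeasure_cube_ne_top
  · rw [← pi_univ_Icc, interior_pi_set finite_univ]
    refine ⟨fun _ => 1 / 2, fun k _ => ?_⟩
    simp only [interior_Icc, Pi.zero_apply, Pi.one_apply]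
    constructor <;> norm_num
  · intro h
    have h1 := volume_le_snowflakeMeasure (s := s) (Icc 0 1)
    rw [h, mul_zero, Real.volume_Icc_pi] at h1
    simp at h1

/-- The Hausdorff measure of `(ℝ^N, d_s)` is positive on the sets of positive volume only. -/
theorem hausdorffMeasure_pos_iff (E : Set (Fin N → ℝ)) :
    0 < Measure.hausdorffMeasure (X := SnowflakeSpace s) (snowflakeDim s) E ↔ 0 < volume E := by
  have := isAddHaarMeasure_snowflakeMeasure (s := s)
  rw [← snowflakeMeasure_apply, pos_iff_ne_zero, pos_iff_ne_zero, not_iff_not]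
  exact ⟨fun h => Measure.absolutelyContinuous_isAddHaarMeasure volume (snowflakeMeasure s) h,
    fun h => Measure.absolutelyContinuous_isAddHaarMeasure (snowflakeMeasure s) volume h⟩

end Snowflake

/-! ### Quotient semi-distances -/

section Quotient

variable {X : Type*} {d : X → X → ℝ} {R : X → X → Prop}

/-- The lengths of the itineraries from `x` to `y`. -/
def itineraryLengths (d : X → X → ℝ) (R : X → X → Prop) (x y : X) : Set ℝ :=
  {t : ℝ | ∃ (n : ℕ) (u v : ℕ → X),
    R x (u 0) ∧ (∀ k < n, R (v k) (u (k + 1))) ∧ R (v n) y ∧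
    t = ∑ k ∈ Finset.range (n + 1), d (u k) (v k)}

theorem dist_mem_itineraryLengths (hR : ∀ x, R x x) (x y : X) :
    d x y ∈ itineraryLengths d R x y :=
  ⟨0, fun _ => x, fun _ => y, hR x, by simp, hR y, by simp⟩

theorem itineraryLengths_nonneg (hd : ∀ x y, 0 ≤ d x y) {x y : X} {t : ℝ}
    (ht : t ∈ itineraryLengths d R x y) : 0 ≤ t := by
  obtain ⟨n, u, v, -, -, -, rfl⟩ := ht
  exact Finset.sum_nonneg fun k _ => hd _ _

theorem quotientSemidist_le (hd : ∀ x y, 0 ≤ d x y) {x y : X} {t : ℝ}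
    (ht : t ∈ itineraryLengths d R x y) : quotientSemidist d R x y ≤ t :=
  csInf_le ⟨0, fun _ => itineraryLengths_nonneg hd⟩ ht

theorem quotientSemidist_le_self (hd : ∀ x y, 0 ≤ d x y) (hR : ∀ x, R x x) (x y : X) :
    quotientSemidist d R x y ≤ d x y :=
  quotientSemidist_le hd (dist_mem_itineraryLengths hR x y)

theorem le_quotientSemidist (hR : ∀ x, R x x) {x y : X} {c : ℝ}
    (h : ∀ t ∈ itineraryLengths d R x y, c ≤ t) : c ≤ quotientSemidist d R x y :=
  le_csInf ⟨_, dist_mem_itineraryLengths hR x y⟩ h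

theorem add_mem_itineraryLengths (hR : Equivalence R) {x y z : X} {t t' : ℝ}
    (ht : t ∈ itineraryLengths d R x y) (ht' : t' ∈ itineraryLengths d R y z) :
    t + t' ∈ itineraryLengths d R x z := by
  obtain ⟨n, u, v, h1, h2, h3, rfl⟩ := ht
  obtain ⟨n', u', v', h1', h2', h3', rfl⟩ := ht'
  -- Concatenation: the first itinerary has `n + 1` steps, so the second starts at index `n + 1`. At
  -- the junction, transitivity of `R` removes the intermediate point `y`.
  refine ⟨n + 1 + n', fun k => if k < n + 1 then u k else u' (k - (n + 1)),
    fun k => if k < n + 1 then v k else v' (k - (n + 1)), by simpa using h1, fun k hk => ?_,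
    by simpa [show ¬ n + 1 + n' ≤ n by omega] using h3', ?_⟩
  · dsimp only
    rcases lt_trichotomy k n with h | h | h
    · rw [if_pos (by omega), if_pos (by omega)]
      exact h2 k h
    · subst h
      rw [if_pos (by omega), if_neg (by omega), Nat.sub_self]
      exact hR.trans h3 h1'
    · rw [if_neg (by omega), if_neg (by omega),
        show k + 1 - (n + 1) = k - (n + 1) + 1 by omega]
      exact h2' _ (by omega)
  · rw [add_assoc (n + 1) n' 1, Finset.sum_range_add _ (n + 1) (n' + 1)]
    congr 1
    · refine Finset.sum_congr rfl fun k hk => ?_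
      dsimp only
      rw [if_pos (Finset.mem_range.1 hk), if_pos (Finset.mem_range.1 hk)]
    · refine Finset.sum_congr rfl fun k _ => ?_
      simp [show ¬ n + 1 + k ≤ n by omega]

theorem quotientSemidist_triangle (hd : ∀ x y, 0 ≤ d x y) (hR : Equivalence R) (x y z : X) :
    quotientSemidist d R x z ≤ quotientSemidist d R x y + quotientSemidist d R y z := by
  rw [← sub_le_iff_le_add]
  refine le_quotientSemidist hR.refl fun t ht => ?_
  rw [sub_le_comm]
  refine le_quotientSemidist hR.refl fun t' ht' => ?_
  rw [sub_le_iff_le_add']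
  exact quotientSemidist_le hd (add_mem_itineraryLengths hR ht ht')

/-- A similarity of `d` which preserves the identifications does not expand the quotient
semi-distance by more than its factor. -/
theorem quotientSemidist_similarity_le (hd : ∀ x y, 0 ≤ d x y) (hR : ∀ x, R x x) {φ : X → X}
    {c : ℝ} (hc : 0 < c) (hφ : ∀ x y, d (φ x) (φ y) = c * d x y)
    (hRφ : ∀ x y, R x y → R (φ x) (φ y)) (x y : X) :
    quotientSemidist d R (φ x) (φ y) ≤ c * quotientSemidist d R x y := by
  rw [← div_le_iff₀' hc]
  refine le_quotientSemidist hR fun t ht => ?_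
  rw [div_le_iff₀' hc]
  refine quotientSemidist_le hd ?_
  obtain ⟨n, u, v, h1, h2, h3, rfl⟩ := ht
  refine ⟨n, φ ∘ u, φ ∘ v, hRφ _ _ h1, fun k hk => hRφ _ _ (h2 k hk), hRφ _ _ h3, ?_⟩
  simp only [Function.comp_apply, hφ, Finset.mul_sum]

end Quotient

/-! ### Self-similarity of the shortcuts -/

theorem shortcuts_scale {l : ℕ} (n : ℕ) (m : ℤ) {x y : ℝ} (h : (x, y) ∈ shortcuts l) :
    ((1 / 2 ^ l : ℝ) ^ n * (x + m), (1 / 2 ^ l : ℝ) ^ n * (y + m)) ∈ shortcuts l := by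
  simp only [shortcuts, mem_iUnion] at h ⊢
  obtain ⟨i, hi, m', hx, hy⟩ := h
  obtain ⟨j, rfl⟩ : ∃ j, i = j + 1 := ⟨i - 1, by omega⟩
  simp only [add_tsub_cancel_right] at hx hy
  have hm : (1 / 2 ^ l : ℝ) ^ j * ((2 ^ l) ^ j * m) = m := by
    rw [← mul_assoc, ← mul_pow, one_div_mul_cancel (by positivity), one_pow, one_mul]
  -- Level `j + 1` has period `h^j`, so translation by the integer `m` shifts the index by `m /
  -- h^j`; scaling by `h^n` raises the level by `n`.
  refine ⟨n + j + 1, by omega, m' + (2 ^ l) ^ j * m, ?_, ?_⟩ <;>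
    simp only [add_tsub_cancel_right]
  · rw [hx]
    push_cast
    linear_combination (-(1 / 2 ^ l : ℝ) ^ n) * hm
  · rw [hy]
    push_cast
    linear_combination (-(1 / 2 ^ l : ℝ) ^ n) * hm

theorem shortcutRel_refl (l : ℕ) (x : ℝ) : shortcutRel l x x := Or.inl rfl

theorem shortcutRel_scale {l : ℕ} (n : ℕ) (m : ℤ) {x y : ℝ} (h : shortcutRel l x y) :
    shortcutRel l ((1 / 2 ^ l : ℝ) ^ n * (x + m)) ((1 / 2 ^ l : ℝ) ^ n * (y + m)) := by
  rcases h with rfl | h | h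
  exacts [Or.inl rfl, Or.inr (Or.inl (shortcuts_scale n m h)),
    Or.inr (Or.inr (shortcuts_scale n m h))]

theorem shortcutDist_scale_le {l : ℕ} {σ : ℝ} (n : ℕ) (m : ℤ) (x y : ℝ) :
    shortcutDist l σ ((1 / 2 ^ l : ℝ) ^ n * (x + m)) ((1 / 2 ^ l : ℝ) ^ n * (y + m))
      ≤ ((1 / 2 ^ l : ℝ) ^ n) ^ σ * shortcutDist l σ x y := by
  refine quotientSemidist_similarity_le (φ := fun x => (1 / 2 ^ l : ℝ) ^ n * (x + m))
    (fun x y => Real.rpow_nonneg (abs_nonneg _) _) (shortcutRel_refl l)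
    (Real.rpow_pos_of_pos (by positivity) _) (fun x y => ?_)
    (fun x y h => shortcutRel_scale n m h) x y
  have hp : (0 : ℝ) ≤ (1 / 2 ^ l : ℝ) ^ n := by positivity
  rw [← Real.mul_rpow hp (abs_nonneg _), ← abs_of_nonneg hp, ← abs_mul, abs_of_nonneg hp]
  ring_nf

/-! ### The semi-distance `d_{s,R}` -/

section Modified

variable {N : ℕ} {s : Fin N → Ioc (0 : ℝ) 1} {l : ℕ}

theorem minFactor_mem_Ioc (hN : 1 ≤ N) : minFactor s ∈ Ioc (0 : ℝ) 1 := by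
  have : Nonempty (Fin N) := ⟨⟨0, hN⟩⟩
  obtain ⟨k, hk⟩ := exists_eq_ciInf_of_finite (f := fun k => (s k : ℝ))
  rw [minFactor, ← hk]
  exact (s k).2

/-- Itineraries with a single step give the bound. It turns Lipschitz maps for `d_{s,R}` into
Lipschitz, hence continuous, maps for `d_s`. -/
theorem modifiedDist_le_snowflakeDist (x y : Fin N → ℝ) :
    modifiedDist s l x y ≤ snowflakeDist s x y := by
  refine Finset.sum_le_sum fun k _ => ?_
  split_ifs with h
  · rw [h]
    exact quotientSemidist_le_self (d := fun x y : ℝ => |x - y| ^ minFactor s)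
      (fun x y => Real.rpow_nonneg (abs_nonneg _) _) (shortcutRel_refl l) _ _
  · exact le_rfl

theorem modifiedDist_triangle (hl : 2 ≤ l) (x y z : Fin N → ℝ) :
    modifiedDist s l x z ≤ modifiedDist s l x y + modifiedDist s l y z := by
  unfold modifiedDist
  rw [← Finset.sum_add_distrib]
  refine Finset.sum_le_sum fun k _ => ?_
  split_ifs with h
  · exact quotientSemidist_triangle (fun x y => Real.rpow_nonneg (abs_nonneg _) _)
      (shortcutRel_equivalence hl) _ _ _
  · exact (Real.rpow_le_rpow (abs_nonneg _) (abs_sub_le (x k) (y k) (z k)) (s k).2.1.le).trans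
      (Real.rpow_add_le_add_rpow (abs_nonneg _) (abs_nonneg _) (s k).2.1.le (s k).2.2)

/-- The map from `[0, 1)^N` onto the cell with index `m` of the grid with mesh `ρ` for `d_s`. -/
noncomputable def gridMap (s : Fin N → Ioc (0 : ℝ) 1) (ρ : ℝ) (m : Fin N → ℤ) (x : Fin N → ℝ) :
    Fin N → ℝ :=
  fun k => ρ ^ (s k : ℝ)⁻¹ * (x k + m k)

theorem abs_mul_rpow_rpow {ρ σ : ℝ} (hρ : 0 ≤ ρ) (hσ : σ ≠ 0) (t : ℝ) :
    |ρ ^ σ⁻¹ * t| ^ σ = ρ * |t| ^ σ := by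
  have h := Real.rpow_nonneg hρ σ⁻¹
  rw [abs_mul, abs_of_nonneg h, Real.mul_rpow h (abs_nonneg _), Real.rpow_inv_rpow hρ hσ]

/-- The scales `h^n` are those at which shortcuts go to shortcuts. Coarser shortcuts are not in the
image, hence an inequality only, in the direction that the blow-up needs. -/
theorem modifiedDist_gridMap_le (hN : 1 ≤ N) (n : ℕ) (m : Fin N → ℤ) (x y : Fin N → ℝ) :
    modifiedDist s l (gridMap s (((1 / 2 ^ l : ℝ) ^ n) ^ minFactor s) m x)
        (gridMap s (((1 / 2 ^ l : ℝ) ^ n) ^ minFactor s) m y)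
      ≤ ((1 / 2 ^ l : ℝ) ^ n) ^ minFactor s * modifiedDist s l x y := by
  unfold modifiedDist
  rw [Finset.mul_sum]
  refine Finset.sum_le_sum fun k _ => ?_
  have hσ : minFactor s ≠ 0 := (minFactor_mem_Ioc (s := s) hN).1.ne'
  split_ifs with h
  · simp only [gridMap, h]
    rw [Real.rpow_rpow_inv (by positivity) hσ]
    exact shortcutDist_scale_le n (m k) (x k) (y k)
  · simp only [gridMap]
    rw [← mul_sub, abs_mul_rpow_rpow (by positivity) (s k).2.1.ne', add_sub_add_right_eq_sub]

end Modified

/-! ### Grids adapted to `d_s` -/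

section Grid

variable {N : ℕ} {s : Fin N → Ioc (0 : ℝ) 1}

theorem snowflakeDist_gridMap {ρ : ℝ} (hρ : 0 ≤ ρ) (m : Fin N → ℤ) (x y : Fin N → ℝ) :
    snowflakeDist s (gridMap s ρ m x) (gridMap s ρ m y) = ρ * snowflakeDist s x y := by
  unfold snowflakeDist
  rw [Finset.mul_sum]
  refine Finset.sum_congr rfl fun k _ => ?_
  simp only [gridMap]
  rw [← mul_sub, abs_mul_rpow_rpow hρ (s k).2.1.ne', add_sub_add_right_eq_sub]

theorem snowflakeDist_le_of_mem_Icc {x y : Fin N → ℝ} (hx : x ∈ Icc 0 1) (hy : y ∈ Icc 0 1) :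
    snowflakeDist s x y ≤ N := by
  calc snowflakeDist s x y ≤ ∑ k : Fin N, (1 : ℝ) := by
        refine Finset.sum_le_sum fun k _ => Real.rpow_le_one (abs_nonneg _) ?_ (s k).2.1.le
        have h1 := hx.1 k
        have h2 := hx.2 k
        have h3 := hy.1 k
        have h4 := hy.2 k
        simp only [Pi.zero_apply, Pi.one_apply] at h1 h2 h3 h4
        exact abs_le.2 ⟨by linarith, by linarith⟩
    _ = N := by simp

theorem volume_gridMap_image {ρ : ℝ} (hρ : 0 ≤ ρ) (m : Fin N → ℤ) (E : Set (Fin N → ℝ)) :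
    volume (gridMap s ρ m '' E) = ENNReal.ofReal (ρ ^ snowflakeDim s) * volume E := by
  let D : Matrix (Fin N) (Fin N) ℝ := Matrix.diagonal fun k => ρ ^ (s k : ℝ)⁻¹
  have himage : gridMap s ρ m '' E
      = Matrix.toLin' D '' ((fun x => x + fun k => (m k : ℝ)) '' E) := by
    rw [image_image]
    refine image_congr fun x _ => funext fun k => ?_
    simp [D, gridMap, Matrix.mulVec_diagonal]
  rw [himage, Measure.addHaar_image_linearMap, LinearMap.det_toLin', Matrix.det_diagonal,
    image_add_right, measure_preimage_add_right, snowflakeDim,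
    Real.rpow_sum_of_nonneg hρ fun k _ => inv_nonneg.2 (s k).2.1.le, abs_of_nonneg
    (Finset.prod_nonneg fun k _ => Real.rpow_nonneg hρ _)]

/-- The half-open unit cube. -/
def unitCell (N : ℕ) : Set (Fin N → ℝ) := univ.pi fun _ => Ico 0 1

theorem unitCell_subset : unitCell N ⊆ Icc 0 1 := fun _ hx =>
  ⟨fun k => (hx k (mem_univ k)).1, fun k => (hx k (mem_univ k)).2.le⟩

theorem unitCell_ae_eq : unitCell N =ᵐ[volume] Icc 0 1 :=
  Measure.univ_pi_Ico_ae_eq_Icc (f := fun _ : Fin N => (0 : ℝ)) (g := fun _ => 1)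

theorem volume_unitCell : volume (unitCell N) = 1 := by
  rw [measure_congr unitCell_ae_eq, Real.volume_Icc_pi]
  simp

/-- The half-open cells of the grid with mesh `ρ` for `d_s`. -/
noncomputable def gridCell (s : Fin N → Ioc (0 : ℝ) 1) (ρ : ℝ) (m : Fin N → ℤ) :
    Set (Fin N → ℝ) :=
  {x | ∀ k, ⌊x k / ρ ^ (s k : ℝ)⁻¹⌋ = m k}

theorem gridMap_mem_gridCell_iff {ρ : ℝ} (hρ : 0 < ρ) (m : Fin N → ℤ) (x : Fin N → ℝ) :
    gridMap s ρ m x ∈ gridCell s ρ m ↔ x ∈ unitCell N := by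
  simp only [gridCell, gridMap, unitCell, mem_ofPred_eq, mem_univ_pi]
  refine forall_congr' fun k => ?_
  rw [mul_div_cancel_left₀ _ (Real.rpow_pos_of_pos hρ _).ne', Int.floor_add_intCast,
    add_eq_right, Int.floor_eq_zero_iff]

theorem gridMap_surjective {ρ : ℝ} (hρ : 0 < ρ) (m : Fin N → ℤ) :
    Function.Surjective (gridMap s ρ m) := fun y =>
  ⟨fun k => y k / ρ ^ (s k : ℝ)⁻¹ - m k, funext fun k => by
    have := (Real.rpow_pos_of_pos hρ (s k : ℝ)⁻¹).ne'
    simp only [gridMap]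
    field_simp
    ring⟩

theorem gridMap_image_inter_preimage {ρ : ℝ} (hρ : 0 < ρ) (m : Fin N → ℤ)
    (E : Set (Fin N → ℝ)) :
    gridMap s ρ m '' (unitCell N ∩ gridMap s ρ m ⁻¹' E) = E ∩ gridCell s ρ m := by
  ext y
  constructor
  · rintro ⟨x, ⟨hx, hE⟩, rfl⟩
    exact ⟨hE, (gridMap_mem_gridCell_iff hρ m x).2 hx⟩
  · rintro ⟨hE, hy⟩
    obtain ⟨x, rfl⟩ := gridMap_surjective (s := s) hρ m y
    exact ⟨x, ⟨(gridMap_mem_gridCell_iff hρ m x).1 hy, hE⟩, rfl⟩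

theorem gridMap_image_unitCell {ρ : ℝ} (hρ : 0 < ρ) (m : Fin N → ℤ) :
    gridMap s ρ m '' unitCell N = gridCell s ρ m := by
  simpa using gridMap_image_inter_preimage (s := s) hρ m univ

theorem volume_gridCell {ρ : ℝ} (hρ : 0 < ρ) (m : Fin N → ℤ) :
    volume (gridCell s ρ m) = ENNReal.ofReal (ρ ^ snowflakeDim s) := by
  rw [← gridMap_image_unitCell hρ, volume_gridMap_image hρ.le, volume_unitCell, mul_one]

theorem snowflakeDist_le_of_mem_gridCell {ρ : ℝ} (hρ : 0 < ρ) {m : Fin N → ℤ}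
    {x y : Fin N → ℝ} (hx : x ∈ gridCell s ρ m) (hy : y ∈ gridCell s ρ m) :
    snowflakeDist s x y ≤ N * ρ := by
  rw [← gridMap_image_unitCell hρ] at hx hy
  obtain ⟨x, hx, rfl⟩ := hx
  obtain ⟨y, hy, rfl⟩ := hy
  rw [snowflakeDist_gridMap hρ.le, mul_comm]
  exact mul_le_mul_of_nonneg_right
    (snowflakeDist_le_of_mem_Icc (unitCell_subset hx) (unitCell_subset hy)) hρ.le

theorem measurableSet_gridCell (ρ : ℝ) (m : Fin N → ℤ) : MeasurableSet (gridCell s ρ m) := by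
  simp only [gridCell, ofPred_forall]
  refine MeasurableSet.iInter fun k => ?_
  exact (Int.measurable_floor.comp (by fun_prop : Measurable fun x : Fin N → ℝ =>
    x k / ρ ^ (s k : ℝ)⁻¹)) (measurableSet_singleton (m k))

theorem pairwise_disjoint_gridCell (ρ : ℝ) :
    Pairwise (Function.onFun Disjoint (gridCell s ρ)) := by
  intro m m' hne
  rw [Function.onFun, disjoint_left]
  exact fun x hx hx' => hne (funext fun k => (hx k).symm.trans (hx' k))

theorem mem_gridCell_floor (ρ : ℝ) (x : Fin N → ℝ) :
    x ∈ gridCell s ρ fun k => ⌊x k / ρ ^ (s k : ℝ)⁻¹⌋ := fun _ => rfl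

/-- Cells are small in the sup metric too, so fine cells meeting `A` lie in a thin closed thickening
of `A`. -/
theorem dist_le_of_mem_gridCell {ρ : ℝ} (hρ : 0 < ρ) {m : Fin N → ℤ}
    {x y : Fin N → ℝ} (hx : x ∈ gridCell s ρ m) (hy : y ∈ gridCell s ρ m) :
    dist x y ≤ ∑ k, (N * ρ) ^ (s k : ℝ)⁻¹ := by
  have hNρ : (0 : ℝ) ≤ N * ρ := by positivity
  refine (dist_pi_le_iff (Finset.sum_nonneg fun k _ => Real.rpow_nonneg hNρ _)).2 fun k => ?_
  rw [Real.dist_eq]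
  refine (abs_le_snowflakeDist_rpow (s := s) x y k).trans ?_
  refine (Real.rpow_le_rpow (snowflakeDist_nonneg _ _) (snowflakeDist_le_of_mem_gridCell hρ hx hy)
    (inv_nonneg.2 (s k).2.1.le)).trans ?_
  exact Finset.single_le_sum (f := fun k => (N * ρ) ^ (s k : ℝ)⁻¹)
    (fun k _ => Real.rpow_nonneg hNρ _) (Finset.mem_univ k)

/-- For a Lipschitz map `F` with image of positive volume on a compact set `A`, there are
arbitrarily full grid cells whose image is not small. -/
theorem exists_full_gridCell {A : Set (Fin N → ℝ)} (hA : IsCompact A) (hAcube : A ⊆ Icc 0 1)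
    {F : (Fin N → ℝ) → Fin N → ℝ} {C : ℝ} (hC : 0 ≤ C)
    (hF : ∀ x ∈ A, ∀ y ∈ A, snowflakeDist s (F x) (F y) ≤ C * snowflakeDist s x y)
    (hpos : 0 < volume (F '' A)) {ρ : ℕ → ℝ} (hρ : ∀ n, 0 < ρ n)
    (hρ0 : Tendsto ρ atTop (𝓝 0)) :
    ∃ c : ENNReal, 0 < c ∧ ∀ ε : ℝ, 0 < ε → ∃ n m,
      volume (gridCell s (ρ n) m \ A) ≤ ENNReal.ofReal ε * volume (gridCell s (ρ n) m) ∧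
      c * volume (gridCell s (ρ n) m) ≤ volume (F '' (A ∩ gridCell s (ρ n) m)) := by
  have hfin : volume (F '' A) ≠ ⊤ := by
    refine ne_top_of_le_ne_top ENNReal.ofReal_ne_top
      (volume_le_of_snowflakeDist_le (s := s) (D := C * N) (by positivity) ?_)
    rintro _ ⟨x, hx, rfl⟩ _ ⟨y, hy, rfl⟩
    exact (hF x hx y hy).trans
      (mul_le_mul_of_nonneg_left (snowflakeDist_le_of_mem_Icc (hAcube hx) (hAcube hy)) hC)
  set M := volume (Metric.cthickening 1 A) with hM
  have hMfin : M ≠ ⊤ := hA.cthickening.measure_ne_top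
  -- Chosen so that cells whose images have less than `c` times their volume account for at most
  -- half of `F '' A`; the `+ 1` keeps the denominator nonzero.
  set c := volume (F '' A) / 2 / (M + 1) with hc
  have hcM : c * M ≤ volume (F '' A) / 2 := by
    calc c * M ≤ c * (M + 1) := by gcongr; exact le_self_add
      _ = _ := ENNReal.div_mul_cancel (by simp) (by finiteness)
  refine ⟨c, ENNReal.div_pos (ENNReal.half_pos hpos.ne').ne' (by finiteness), fun ε hε => ?_⟩
  by_contra! hbad
  have hcfin : c ≠ ⊤ := ENNReal.div_ne_top (by finiteness) (by simp)
  set K := ENNReal.ofReal (2 ^ N * (C * N) ^ snowflakeDim s) with hK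
  -- If no good cell exists, a nearly full cell has image below `c` times its volume. In any other
  -- cell the Lipschitz bound `K * volume` is absorbed by the part outside `A`, which exceeds a
  -- proportion `ε`.
  have hcell : ∀ n m, volume (F '' (A ∩ gridCell s (ρ n) m))
      ≤ K / ENNReal.ofReal ε * volume (gridCell s (ρ n) m \ A)
        + c * volume (gridCell s (ρ n) m) := by
    intro n m
    have hε0 : ENNReal.ofReal ε ≠ 0 := (ENNReal.ofReal_pos.2 hε).ne'
    by_cases h : volume (gridCell s (ρ n) m \ A)
        ≤ ENNReal.ofReal ε * volume (gridCell s (ρ n) m)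
    · exact (hbad n m h).le.trans le_add_self
    · refine le_trans ?_ le_self_add
      calc volume (F '' (A ∩ gridCell s (ρ n) m))
          ≤ ENNReal.ofReal (2 ^ N * (C * (N * ρ n)) ^ snowflakeDim s) := by
            refine volume_le_of_snowflakeDist_le (s := s) (mul_nonneg hC
              (mul_nonneg (Nat.cast_nonneg _) (hρ n).le)) ?_
            rintro _ ⟨x, hx, rfl⟩ _ ⟨y, hy, rfl⟩
            exact (hF x hx.1 y hy.1).trans
              (mul_le_mul_of_nonneg_left (snowflakeDist_le_of_mem_gridCell (hρ n) hx.2 hy.2) hC)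
        _ = K * volume (gridCell s (ρ n) m) := by
            rw [volume_gridCell (hρ n), hK, ← ENNReal.ofReal_mul (by positivity), ← mul_assoc,
              Real.mul_rpow (by positivity) (hρ n).le, mul_assoc]
        _ = K / ENNReal.ofReal ε * (ENNReal.ofReal ε * volume (gridCell s (ρ n) m)) := by
            rw [← mul_assoc, ENNReal.div_mul_cancel hε0 ENNReal.ofReal_ne_top]
        _ ≤ _ := by gcongr; exact (not_le.1 h).le
  let δ : ℕ → ℝ := fun n => ∑ k, (N * ρ n) ^ (s k : ℝ)⁻¹
  have hδ0 : Tendsto δ atTop (𝓝 0) := by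
    have h : Tendsto δ atTop (𝓝 (∑ k, ((N : ℝ) * 0) ^ (s k : ℝ)⁻¹)) :=
      tendsto_finsetSum _ fun k _ => (hρ0.const_mul _).rpow_const
        (Or.inr (inv_nonneg.2 (s k).2.1.le))
    simpa [fun k => Real.zero_rpow (inv_ne_zero (s k).2.1.ne')] using h
  have hsum : ∀ n, volume (F '' A) ≤ K / ENNReal.ofReal ε
      * volume (Metric.cthickening (δ n) A \ A) + c * volume (Metric.cthickening (δ n) A) := by
    intro n
    let B : Set (Fin N → ℤ) := {m | (A ∩ gridCell s (ρ n) m).Nonempty}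
    have hdis : Pairwise (Function.onFun Disjoint fun m : B => gridCell s (ρ n) m) :=
      fun m m' h => pairwise_disjoint_gridCell (s := s) (ρ n) (Subtype.coe_injective.ne h)
    have hU : ⋃ m : B, gridCell s (ρ n) m ⊆ Metric.cthickening (δ n) A := by
      refine iUnion_subset fun m x hx => ?_
      obtain ⟨y, hyA, hy⟩ := m.2
      exact Metric.mem_cthickening_of_dist_le x y _ _ hyA (dist_le_of_mem_gridCell (hρ n) hx hy)
    have hAU : F '' A ⊆ ⋃ m : B, F '' (A ∩ gridCell s (ρ n) m) := by
      rintro _ ⟨x, hx, rfl⟩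
      have h := mem_gridCell_floor (s := s) (ρ n) x
      exact mem_iUnion.2 ⟨⟨_, x, hx, h⟩, x, ⟨hx, h⟩, rfl⟩
    calc volume (F '' A) ≤ ∑' m : B, volume (F '' (A ∩ gridCell s (ρ n) m)) :=
          (measure_mono hAU).trans (measure_iUnion_le _)
      _ ≤ ∑' m : B, (K / ENNReal.ofReal ε * volume (gridCell s (ρ n) m \ A)
            + c * volume (gridCell s (ρ n) m)) := ENNReal.tsum_le_tsum fun m => hcell n m
      _ = K / ENNReal.ofReal ε * volume ((⋃ m : B, gridCell s (ρ n) m) \ A)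
            + c * volume (⋃ m : B, gridCell s (ρ n) m) := by
          rw [ENNReal.tsum_add, ENNReal.tsum_mul_left, ENNReal.tsum_mul_left,
            measure_iUnion hdis fun m => measurableSet_gridCell _ _, iUnion_sdiff,
            measure_iUnion (fun m m' h => (hdis h).mono sdiff_subset sdiff_subset)
              fun m => (measurableSet_gridCell _ _).diff hA.measurableSet]
      _ ≤ _ := by gcongr
  have hlim : Tendsto (fun n => volume (Metric.cthickening (δ n) A)) atTop (𝓝 (volume A)) :=
    (tendsto_measure_cthickening_of_isCompact hA).comp hδ0
  have hAfin : volume A ≠ ⊤ := hA.measure_ne_top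
  have hlim' : Tendsto (fun n => volume (Metric.cthickening (δ n) A \ A)) atTop (𝓝 0) := by
    have h := ENNReal.Tendsto.sub hlim tendsto_const_nhds (Or.inl hAfin) (b := volume A)
    rw [tsub_self] at h
    refine h.congr fun n => ?_
    rw [measure_sdiff (Metric.self_subset_cthickening A) hA.measurableSet.nullMeasurableSet hAfin]
  have hKε : K / ENNReal.ofReal ε ≠ ⊤ :=
    ENNReal.div_ne_top ENNReal.ofReal_ne_top (ENNReal.ofReal_pos.2 hε).ne'
  -- As `A` is compact, its thickenings shrink to it in volume. The part outside `A` disappears in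
  -- the limit, leaving at most half of the volume of `F '' A`: a contradiction.
  have hfinal := (ENNReal.Tendsto.const_mul hlim' (Or.inr hKε)).add
    (ENNReal.Tendsto.const_mul hlim (Or.inr hcfin))
  rw [mul_zero, zero_add] at hfinal
  have h1 : volume (F '' A) ≤ c * volume A := ge_of_tendsto' hfinal hsum
  have h2 : c * volume A ≤ c * M := by rw [hM]; gcongr; exact Metric.self_subset_cthickening A
  exact (ENNReal.half_lt_self hpos.ne' hfin).not_ge (h1.trans (h2.trans hcM))

end Grid

/-! ### Blow-ups and their limits -/

section BlowUp

variable {N : ℕ} {s : Fin N → Ioc (0 : ℝ) 1} {l : ℕ}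

/-- Blowing up a Lipschitz map on `A` at full cells of fine grids gives maps with the same
Lipschitz constant on nearly full subsets of the cube, whose images do not get small. -/
theorem exists_blowUp (hN : 1 ≤ N) (hl : 1 ≤ l) {A : Set (Fin N → ℝ)} (hA : IsCompact A)
    (hAcube : A ⊆ Icc 0 1) {F : (Fin N → ℝ) → Fin N → ℝ} {C : ℝ} (hC : 0 ≤ C)
    (hF : ∀ x ∈ A, ∀ y ∈ A, snowflakeDist s (F x) (F y) ≤ C * modifiedDist s l x y)
    (hpos : 0 < volume (F '' A)) :
    ∃ c : ENNReal, 0 < c ∧ ∀ ε : ℝ, 0 < ε → ∃ (E : Set (Fin N → ℝ)) (G : (Fin N → ℝ) → Fin N → ℝ),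
      E ⊆ Icc 0 1 ∧
      (∀ x ∈ E, ∀ y ∈ E, snowflakeDist s (G x) (G y) ≤ C * modifiedDist s l x y) ∧
      (∀ x ∈ E, snowflakeDist s (G x) 0 ≤ C * N) ∧
      volume (Icc 0 1 \ E) ≤ ENNReal.ofReal ε ∧ c ≤ volume (G '' E) := by
  have hσ := (minFactor_mem_Ioc (s := s) hN).1
  let ρ : ℕ → ℝ := fun n => ((1 / 2 ^ l : ℝ) ^ n) ^ minFactor s
  have hρ : ∀ n, 0 < ρ n := fun n => Real.rpow_pos_of_pos (by positivity) _
  have hρ0 : Tendsto ρ atTop (𝓝 0) := by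
    have h1 : (1 / 2 ^ l : ℝ) < 1 :=
      (div_lt_one (by positivity)).2 (one_lt_pow₀ one_lt_two (by omega))
    have h := (tendsto_pow_atTop_nhds_zero_of_lt_one (by positivity) h1).rpow_const
      (p := minFactor s) (Or.inr hσ.le)
    rwa [Real.zero_rpow hσ.ne'] at h
  obtain ⟨c, hc, hcells⟩ := exists_full_gridCell hA hAcube hC
    (fun x hx y hy => (hF x hx y hy).trans
      (mul_le_mul_of_nonneg_left (modifiedDist_le_snowflakeDist x y) hC)) hpos hρ hρ0
  refine ⟨c, hc, fun ε hε => ?_⟩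
  obtain ⟨n, m, hfull, himage⟩ := hcells ε hε
  let v := ENNReal.ofReal (ρ n ^ snowflakeDim s)
  have hv0 : v ≠ 0 := (ENNReal.ofReal_pos.2 (Real.rpow_pos_of_pos (hρ n) _)).ne'
  have hvfin : v ≠ ⊤ := ENNReal.ofReal_ne_top
  rw [volume_gridCell (hρ n)] at hfull himage
  let E : Set (Fin N → ℝ) := unitCell N ∩ gridMap s (ρ n) m ⁻¹' A
  -- The target is rescaled by the inverse of the linear grid map, so the factors `ρ n` in the
  -- Lipschitz bound and `ρ n ^ α` in the volumes cancel.
  choose inv hinv using gridMap_surjective (s := s) (hρ n) (0 : Fin N → ℤ)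
  let G₀ : (Fin N → ℝ) → Fin N → ℝ := fun x => inv (F (gridMap s (ρ n) m x))
  have hG₀ : ∀ x, gridMap s (ρ n) 0 (G₀ x) = F (gridMap s (ρ n) m x) := fun x => hinv _
  have hEcube : E ⊆ Icc 0 1 := inter_subset_left.trans unitCell_subset
  have hlip : ∀ x ∈ E, ∀ y ∈ E, snowflakeDist s (G₀ x) (G₀ y) ≤ C * modifiedDist s l x y := by
    intro x hx y hy
    refine le_of_mul_le_mul_left ?_ (hρ n)
    rw [← snowflakeDist_gridMap (hρ n).le 0, hG₀, hG₀, mul_left_comm]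
    exact (hF _ hx.2 _ hy.2).trans (mul_le_mul_of_nonneg_left (modifiedDist_gridMap_le hN n m x y) hC)
  have hvol : c ≤ volume (G₀ '' E) := by
    rw [← gridMap_image_inter_preimage (hρ n), image_image] at himage
    simp_rw [← hG₀] at himage
    rw [← image_image (gridMap s (ρ n) 0) G₀, volume_gridMap_image (hρ n).le, mul_comm] at himage
    exact (ENNReal.mul_le_mul_iff_right hv0 hvfin).1 himage
  obtain ⟨a, ha⟩ : E.Nonempty := by
    by_contra! h
    rw [h, image_empty, measure_empty] at hvol
    exact hc.not_ge hvol
  -- Translating so that `a ∈ E` goes to the origin makes the blow-ups uniformly bounded, which the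
  -- limit requires.
  have hsub : ∀ x y, snowflakeDist s (G₀ x - G₀ a) (G₀ y - G₀ a) = snowflakeDist s (G₀ x) (G₀ y) :=
    fun x y => by simp [snowflakeDist]
  refine ⟨E, fun x => G₀ x - G₀ a, hEcube, fun x hx y hy => (hsub x y).trans_le (hlip x hx y hy),
    fun x hx => ?_, ?_, ?_⟩
  · have h := (hsub x a).trans_le (hlip x hx a ha)
    rw [sub_self] at h
    exact h.trans (mul_le_mul_of_nonneg_left ((modifiedDist_le_snowflakeDist x a).trans
      (snowflakeDist_le_of_mem_Icc (hEcube hx) (hEcube ha))) hC)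
  · have h1 : volume (unitCell N \ E) ≤ ENNReal.ofReal ε := by
      have h2 : gridMap s (ρ n) m '' (unitCell N \ E) = gridCell s (ρ n) m \ A := by
        have h3 : unitCell N \ E = unitCell N ∩ gridMap s (ρ n) m ⁻¹' Aᶜ := by
          ext x
          simp only [E, Set.mem_sdiff, mem_inter_iff, mem_preimage, mem_compl_iff]
          tauto
        rw [h3, gridMap_image_inter_preimage (hρ n), inter_comm, Set.sdiff_eq]
      rw [← h2, volume_gridMap_image (hρ n).le, mul_comm (ENNReal.ofReal ε)] at hfull
      exact (ENNReal.mul_le_mul_iff_right hv0 hvfin).1 hfull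
    refine (measure_congr ?_).trans_le h1
    exact unitCell_ae_eq.symm.diff (ae_eq_refl E)
  · have h : (fun x => G₀ x - G₀ a) '' E = (fun x => x - G₀ a) '' (G₀ '' E) := by
      rw [image_image]
    simp_rw [sub_eq_add_neg] at h ⊢
    rwa [h, image_add_right, measure_preimage_add_right]

/-- A sequence of subsets of the cube whose complements shrink to measure zero is asymptotically
dense. -/
theorem exists_tendsto_of_volume_compl {E : ℕ → Set (Fin N → ℝ)} (hE : ∀ n, (E n).Nonempty)
    (hvol : Tendsto (fun n => volume (Icc 0 1 \ E n)) atTop (𝓝 0)) {x : Fin N → ℝ}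
    (hx : x ∈ Icc 0 1) : ∃ a : ℕ → Fin N → ℝ, (∀ n, a n ∈ E n) ∧ Tendsto a atTop (𝓝 x) := by
  have hchoice : ∀ n : ℕ, ∃ y ∈ E n, dist x y < Metric.infDist x (E n) + 1 / ((n : ℝ) + 1) :=
    fun n => (Metric.infDist_lt_iff (hE n)).1 (lt_add_of_pos_right _ (by positivity))
  choose a ha hdist using hchoice
  refine ⟨a, ha, ?_⟩
  have hinf : Tendsto (fun n => Metric.infDist x (E n)) atTop (𝓝 0) := by
    refine tendsto_order.2 ⟨fun b hb => Eventually.of_forall fun n =>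
      hb.trans_le Metric.infDist_nonneg, fun b hb => ?_⟩
    -- Points of the boundary are limits of interior ones, so each ball about `x` meets the cube in
    -- positive volume, which `E n` cannot eventually miss.
    have hxcl : x ∈ closure (interior (Icc (0 : Fin N → ℝ) 1)) := by
      have hne : (interior (Icc (0 : Fin N → ℝ) 1)).Nonempty := by
        rw [← pi_univ_Icc, interior_pi_set finite_univ]
        refine ⟨fun _ => 1 / 2, fun k _ => ?_⟩
        simp only [interior_Icc, Pi.zero_apply, Pi.one_apply]
        constructor <;> norm_num
      rw [(convex_Icc (𝕜 := ℝ) (0 : Fin N → ℝ) 1).closure_interior_eq_closure_of_nonempty_interior hne]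
      exact subset_closure hx
    have hne : (Metric.ball x b ∩ interior (Icc (0 : Fin N → ℝ) 1)).Nonempty :=
      mem_closure_iff.1 hxcl _ Metric.isOpen_ball (Metric.mem_ball_self hb)
    have hpos := (Metric.isOpen_ball.inter isOpen_interior).measure_pos volume hne
    filter_upwards [hvol.eventually_lt_const hpos] with n hn
    obtain ⟨y, hy, hyE⟩ : ((Metric.ball x b ∩ interior (Icc 0 1)) ∩ E n).Nonempty := by
      by_contra! h
      refine hn.not_ge (measure_mono fun y hy => ⟨interior_subset hy.2, fun hyE => ?_⟩)
      exact (h ▸ (⟨hy, hyE⟩ : y ∈ _ ∩ E n) : y ∈ (∅ : Set (Fin N → ℝ)))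
    exact (Metric.infDist_le_dist_of_mem hyE).trans_lt (by rw [dist_comm]; exact hy.1)
  rw [tendsto_iff_dist_tendsto_zero]
  have h := hinf.add tendsto_one_div_add_atTop_nhds_zero_nat
  rw [add_zero] at h
  exact squeeze_zero (fun _ => dist_nonneg) (fun n => by rw [dist_comm]; exact (hdist n).le) h

theorem continuousOn_of_snowflakeDist_le {f : (Fin N → ℝ) → Fin N → ℝ} {E : Set (Fin N → ℝ)}
    {C : ℝ} (hf : ∀ x ∈ E, ∀ y ∈ E, snowflakeDist s (f x) (f y) ≤ C * snowflakeDist s x y) :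
    ContinuousOn f E := by
  intro x hx
  have h1 : Tendsto (fun y => C * snowflakeDist s y x) (𝓝[E] x) (𝓝 0) := by
    have hcont : Continuous fun y : Fin N → ℝ => C * snowflakeDist s y x :=
      continuous_const.mul (continuous_snowflakeDist.comp
        (by fun_prop : Continuous fun y : Fin N → ℝ => (y, x)))
    have := (hcont.tendsto x).mono_left (nhdsWithin_le_nhds (s := E))
    rwa [snowflakeDist_self, mul_zero] at this
  have h2 : Tendsto (fun y => (SnowflakeSpace.homeomorph s).symm (f y)) (𝓝[E] x)
      (𝓝 ((SnowflakeSpace.homeomorph s).symm (f x))) := by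
    rw [tendsto_iff_dist_tendsto_zero]
    refine squeeze_zero' (Eventually.of_forall fun _ => dist_nonneg) ?_ h1
    filter_upwards [self_mem_nhdsWithin] with y hy using hf y hy x hx
  exact ((SnowflakeSpace.homeomorph s).continuous.tendsto _).comp h2

/-- A limit, along an ultrafilter, of Lipschitz maps on asymptotically dense subsets of the cube
is a Lipschitz map on the whole cube, whose image is at least as large. -/
theorem exists_limit_map (hl : 2 ≤ l) {C : ℝ} (hC : 0 ≤ C) {c : ENNReal} (hc : 0 < c)
    {E : ℕ → Set (Fin N → ℝ)} {G : ℕ → (Fin N → ℝ) → Fin N → ℝ} (hE : ∀ n, E n ⊆ Icc 0 1)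
    (hG : ∀ n, ∀ x ∈ E n, ∀ y ∈ E n,
      snowflakeDist s (G n x) (G n y) ≤ C * modifiedDist s l x y)
    (hbdd : ∀ n, ∀ x ∈ E n, snowflakeDist s (G n x) 0 ≤ C * N)
    (hvol : Tendsto (fun n => volume (Icc 0 1 \ E n)) atTop (𝓝 0))
    (himage : ∀ n, c ≤ volume (G n '' E n)) :
    ∃ f : (Fin N → ℝ) → Fin N → ℝ,
      (∀ x ∈ Icc 0 1, ∀ y ∈ Icc 0 1, snowflakeDist s (f x) (f y) ≤ C * modifiedDist s l x y) ∧
      c ≤ volume (f '' Icc 0 1) := by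
  have hne : ∀ n, (E n).Nonempty := fun n => by
    by_contra! h
    have := himage n
    rw [h, image_empty, measure_empty] at this
    exact hc.not_ge this
  -- Along an ultrafilter every sequence in a compact set converges, so the limits exist at all
  -- points of the cube at once, without extracting subsequences.
  let U : Ultrafilter ℕ := hyperfilter ℕ
  have hU : (U : Filter ℕ) ≤ atTop := by
    rw [← Nat.cofinite_eq_atTop]
    exact hyperfilter_le_cofinite
  have happrox : ∀ x : Fin N → ℝ, ∃ a : ℕ → Fin N → ℝ, (∀ n, a n ∈ E n) ∧
      (x ∈ Icc 0 1 → Tendsto a atTop (𝓝 x)) := fun x => by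
    by_cases hx : x ∈ Icc 0 1
    · obtain ⟨a, ha, hlim⟩ := exists_tendsto_of_volume_compl hne hvol hx
      exact ⟨a, ha, fun _ => hlim⟩
    -- Outside the cube any sequence with `a n ∈ E n` will do; it only makes `f` total.
    · choose a ha using hne
      exact ⟨a, ha, fun h => (hx h).elim⟩
  choose a ha hlim using happrox
  have hcompact : ∀ b : ℕ → Fin N → ℝ, (∀ n, b n ∈ E n) →
      ∃ y, Tendsto (fun n => G n (b n)) U (𝓝 y) := by
    intro b hb
    let K : Set (Fin N → ℝ) := Icc (fun k => -(C * N) ^ (s k : ℝ)⁻¹) fun k => (C * N) ^ (s k : ℝ)⁻¹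
    have hK : ∀ n, G n (b n) ∈ K := fun n => by
      have h : ∀ k, |G n (b n) k| ≤ (C * N) ^ (s k : ℝ)⁻¹ := fun k => by
        have h1 := (abs_le_snowflakeDist_rpow (s := s) (G n (b n)) 0 k).trans
          (Real.rpow_le_rpow (snowflakeDist_nonneg _ _) (hbdd n _ (hb n))
            (inv_nonneg.2 (s k).2.1.le))
        simpa using h1
      exact ⟨fun k => (abs_le.1 (h k)).1, fun k => (abs_le.1 (h k)).2⟩
    obtain ⟨y, -, hy⟩ := isCompact_Icc.ultrafilter_le_nhds (s := K) (U.map fun n => G n (b n))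
      (le_principal_iff.2 (mem_map.2 (Eventually.of_forall hK)))
    exact ⟨y, hy⟩
  choose f hf using fun x => hcompact (a x) (ha x)
  have hflip : ∀ x ∈ Icc 0 1, ∀ y ∈ Icc 0 1,
      snowflakeDist s (f x) (f y) ≤ C * modifiedDist s l x y := by
    intro x hx y hy
    have h1 := ((hlim x hx).mono_left hU).snowflakeDist (s := s) (tendsto_const_nhds (x := x))
    have h2 := (tendsto_const_nhds (x := y)).snowflakeDist (s := s) ((hlim y hy).mono_left hU)
    rw [snowflakeDist_self] at h1 h2
    have h3 := ((h1.add_const (modifiedDist s l x y)).add h2).const_mul C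
    rw [zero_add, add_zero] at h3
    have h5 := (hf x).snowflakeDist (s := s) (hf y)
    refine le_of_tendsto_of_tendsto' h5 h3 fun n => ?_
    -- Two triangle inequalities and `d_{s,R} ≤ d_s` replace continuity of `d_{s,R}`.
    have h4 : modifiedDist s l (a x n) (a y n)
        ≤ snowflakeDist s (a x n) x + modifiedDist s l x y + snowflakeDist s y (a y n) := by
      linarith [modifiedDist_triangle (s := s) hl (a x n) x (a y n),
        modifiedDist_triangle (s := s) hl x y (a y n),
        modifiedDist_le_snowflakeDist (s := s) (l := l) (a x n) x,
        modifiedDist_le_snowflakeDist (s := s) (l := l) y (a y n)]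
    exact (hG n _ (ha x n) _ (ha y n)).trans (mul_le_mul_of_nonneg_left h4 hC)
  refine ⟨f, hflip, ?_⟩
  have hK : IsCompact (f '' Icc 0 1) := isCompact_Icc.image_of_continuousOn
    (continuousOn_of_snowflakeDist_le fun x hx y hy => (hflip x hx y hy).trans
      (mul_le_mul_of_nonneg_left (modifiedDist_le_snowflakeDist x y) hC))
  have hthick : ∀ η : ℝ, 0 < η → c ≤ volume (Metric.cthickening η (f '' Icc 0 1)) := by
    intro η hη
    suffices h : ∃ n, G n '' E n ⊆ Metric.cthickening η (f '' Icc 0 1) by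
      obtain ⟨n, hn⟩ := h
      exact (himage n).trans (measure_mono hn)
    -- Otherwise some `z n ∈ E n` have values `G n (z n)` outside the thickening. If `x` is their
    -- limit, then `z n` and `a x n` come together, so by the common Lipschitz constant `G n (z n)`
    -- tends to `f x`, an interior point of the thickening.
    by_contra! hfar
    have hfar' : ∀ n, ∃ z ∈ E n, G n z ∉ Metric.cthickening η (f '' Icc 0 1) := fun n => by
      obtain ⟨_, ⟨z, hz, rfl⟩, h⟩ := not_subset.1 (hfar n)
      exact ⟨z, hz, h⟩
    choose z hz hzfar using hfar'
    obtain ⟨x, hx, hzx⟩ := isCompact_Icc.ultrafilter_le_nhds (s := Icc (0 : Fin N → ℝ) 1) (U.map z)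
      (le_principal_iff.2 (mem_map.2 (Eventually.of_forall fun n => hE n (hz n))))
    have hzx' : Tendsto z U (𝓝 x) := hzx
    obtain ⟨y, hy⟩ := hcompact z hz
    have h1 := (hzx'.snowflakeDist (s := s) ((hlim x hx).mono_left hU)).const_mul C
    rw [snowflakeDist_self, mul_zero] at h1
    have h2 : snowflakeDist s y (f x) ≤ 0 :=
      le_of_tendsto_of_tendsto' (hy.snowflakeDist (s := s) (hf x)) h1 fun n =>
        (hG n _ (hz n) _ (ha x n)).trans
          (mul_le_mul_of_nonneg_left (modifiedDist_le_snowflakeDist _ _) hC)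
    have hyx : y = f x := dist_le_zero (γ := SnowflakeSpace s).1 h2
    have hnhds : Metric.cthickening η (f '' Icc 0 1) ∈ 𝓝 y :=
      mem_of_superset (Metric.isOpen_thickening.mem_nhds
        (Metric.self_subset_thickening hη _ (hyx ▸ mem_image_of_mem f hx)))
        (Metric.thickening_subset_cthickening _ _)
    obtain ⟨n, hn⟩ := (hy.eventually_mem hnhds).exists
    exact hzfar n hn
  have hlim0 := (tendsto_measure_cthickening_of_isCompact (μ := volume) hK).mono_left
    (nhdsWithin_le_nhds (s := Ioi 0))
  exact ge_of_tendsto hlim0 (by filter_upwards [self_mem_nhdsWithin] with η hη using hthick η hη)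

end BlowUp

/-! ### Conclusion: the limit of blow-ups with vanishing defect -/

theorem mainTheorem2 {N : ℕ} (hN : 1 ≤ N) (s : Fin N → Set.Ioc (0 : ℝ) 1)
    (hs : ∑ k, (s k : ℝ) < N)
    (l : ℕ) (hl : LargeEnough l (minFactor s))
    (A : Set (Fin N → ℝ)) (hAcube : A ⊆ Set.Icc 0 1) (hA : IsClosed A)
    (g : (Fin N → ℝ) → SnowflakeSpace s)
    (hg : IsLipschitzOn (modifiedDist s l) dist A g)
    (hpos : 0 < MeasureTheory.Measure.hausdorffMeasure (snowflakeDim s) (g '' A)) :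
    ∃ f : (Fin N → ℝ) → SnowflakeSpace s,
      IsLipschitzOn (modifiedDist s l) dist (Set.Icc 0 1) f ∧
      0 < MeasureTheory.Measure.hausdorffMeasure (snowflakeDim s) (f '' Set.Icc 0 1) := by
  have hl2 : 2 ≤ l := hl.two_le (minFactor_mem_Ioc hN).2
  obtain ⟨C, hC, hlip⟩ := hg
  obtain ⟨c, hc, hblow⟩ := exists_blowUp (s := s) hN (by omega : 1 ≤ l)
    (isCompact_Icc.of_isClosed_subset hA hAcube) hAcube (F := g) hC hlip
    ((hausdorffMeasure_pos_iff (s := s) (g '' A)).1 hpos)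
  choose E G hE hG hbdd hvol himage using fun n : ℕ =>
    hblow (1 / ((n : ℝ) + 1)) (by positivity)
  have hvol0 : Tendsto (fun n => volume (Icc 0 1 \ E n)) atTop (𝓝 0) := by
    refine tendsto_of_tendsto_of_tendsto_of_le_of_le tendsto_const_nhds ?_
      (fun _ => zero_le) hvol
    rw [← ENNReal.ofReal_zero]
    exact ENNReal.tendsto_ofReal tendsto_one_div_add_atTop_nhds_zero_nat
  obtain ⟨f, hf, hfvol⟩ := exists_limit_map hl2 hC hc hE hG hbdd hvol0 himage
  exact ⟨f, ⟨C, hC, hf⟩, (hausdorffMeasure_pos_iff (s := s) (f '' Icc 0 1)).2 (hc.trans_le hfvol)⟩
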